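/- Throughout, a triangle $K\subset\mathbb R^2$ is closed and nondegenerate, and $h_K:=\operatorname{diam}K$. For an open set $U\subset\mathbb R^2$, $H^1(U)$ is the space of all $f\in L^2(U)$ whose distributional derivatives $\partial f/\partial x_1$, $\partial f/\partial x_2$ belong to $L^2(U)$, with $$|f|_{0,U}:=\|f\|_{L^2(U)},\qquad |f|_{1,U}:=\Big(\|\partial f/\partial x_1\|_{L^2(U)}^2+\|\partial f/\partial x_2\|_{L^2(U)}^2\Big)^{1/2}.$$ For a triangle $K$, $H^1(K)$, $|\cdot|_{0,K}$ and $|\cdot|_{1,K}$ refer to the interior of $K$, and $\pi_K^0f:=\frac1{|K|}\int_Kf\,dx$. A proper triangulation of a bounded domain (bounded, nonempty, connected open set) $\Omega\subset\mathbb R^2$ is a finite set $\mathcal T_h$ of triangles such that $\overline\Omega=\bigcup_{K\in\mathcal T_h}K$, the interior of each $K\in\mathcal T_h$ is contained in $\Omega$ (this is automatic if $\Omega$ is the interior of $\overline\Omega$), and any two distinct triangles of $\mathcal T_h$ are disjoint or intersect exactly in a common vertex or a common edge. Put $h:=\max_{K\in\mathcal T_h}h_K$, and let $\pi_\Omega^0f$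 be the piecewise constant function with $\pi_\Omega^0f=\pi_K^0f$ in the interior of each $K\in\mathcal T_h$. **Theorem.** There is an absolute constant $C_2^{(1)}>0$, independent of all triangles, domains, triangulations and functions, such that: 1. for every triangle $K$, $$B_2^{(1)}(K):=\sup\Big\{\frac{|v|_{0,K}}{|v|_{1,K}}\;:\;v\in H^1(K),\ \int_Kv\,dx=0\Big\}\le C_2^{(1)}h_K$$ (with $0/0:=0$); 2. for every triangle $K$ and every $f\in H^1(K)$, $$|f-\pi_K^0f|_{0,K}\le C_2^{(1)}\,h_K\,|f|_{1,K};$$ 3. for every bounded domain $\Omega\subset\mathbb R^2$, every proper triangulation $\mathcal T_h$ of $\Omega$ and every $f\in H^1(\Omega)$, $$|f-\pi_\Omega^0f|_{0,\Omega}\le C_2^{(1)}\,h\,|f|_{1,\Omega}.$$ -/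

import Mathlib

open MeasureTheory
open scoped ENNReal NNReal ContDiff

/-- The Euclidean plane. -/
abbrev Plane : Type := EuclideanSpace ℝ (Fin 2)

/-- `p` lists the vertices of the nondegenerate closed triangle `K`. -/
def IsVertexList (p : Fin 3 → Plane) (K : Set Plane) : Prop :=
  AffineIndependent ℝ p ∧ K = convexHull ℝ (Set.range p)

/-- `K` is a (closed, nondegenerate) triangle. -/
def IsTriangle (K : Set Plane) : Prop := ∃ p : Fin 3 → Plane, IsVertexList p K

/-- `x` is a vertex of the triangle `K`. -/
def IsTriangleVertex (x : Plane) (K : Set Plane) : Prop :=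
  ∃ p : Fin 3 → Plane, IsVertexList p K ∧ ∃ i, x = p i

/-- `e` is a (closed) edge of the triangle `K`. -/
def IsTriangleEdge (e K : Set Plane) : Prop :=
  ∃ p : Fin 3 → Plane, IsVertexList p K ∧ ∃ i j, i ≠ j ∧ e = segment ℝ (p i) (p j)

/-- `T` is a proper (face-to-face) triangulation of `Ω`: a finite set of triangles whose union is
the closure of `Ω`, two different ones being disjoint or meeting in a common vertex or a common
edge. The field `interior_subset` says that the open triangles lie in `Ω`, so that a function on
`Ω` restricts to each of them. It follows from `closure_eq` whenever `Ω` is the interior of its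
closure (see `interior_subset_of_closure_eq`); it only rules out slits of `Ω` that run through
the inside of a triangle. -/
structure IsProperTriangulation (Ω : Set Plane) (T : Finset (Set Plane)) : Prop where
  isTriangle : ∀ K ∈ T, IsTriangle K
  closure_eq : closure Ω = ⋃ K ∈ T, K
  interior_subset : ∀ K ∈ T, interior K ⊆ Ω
  face_to_face : ∀ K₁ ∈ T, ∀ K₂ ∈ T, K₁ ≠ K₂ →
    K₁ ∩ K₂ = ∅ ∨
    (∃ x, IsTriangleVertex x K₁ ∧ IsTriangleVertex x K₂ ∧ K₁ ∩ K₂ = {x}) ∨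
    (∃ e, IsTriangleEdge e K₁ ∧ IsTriangleEdge e K₂ ∧ K₁ ∩ K₂ = e)

theorem interior_subset_of_closure_eq {Ω : Set Plane} {T : Finset (Set Plane)}
    (hΩ : interior (closure Ω) = Ω) (hT : closure Ω = ⋃ K ∈ T, K) :
    ∀ K ∈ T, interior K ⊆ Ω := by
  intro K hK
  rw [← hΩ, hT]
  exact interior_mono (Set.subset_biUnion_of_mem (u := fun K : Set Plane => K) hK)

/-- `h = max_{K ∈ T} diam K`. -/
noncomputable def meshSize (T : Finset (Set Plane)) : ℝ≥0∞ := T.sup fun K => Metric.ediam K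

/-- The norm `|f|_{0,S}` of `L²(S)`, as an extended nonnegative real. -/
noncomputable def l2Norm (S : Set Plane) (f : Plane → ℝ) : ℝ≥0∞ :=
  eLpNorm f 2 (volume.restrict S)

/-- `g ∈ L²(U)` is the distributional partial derivative `∂f/∂xᵢ` on the open set `U`. -/
def IsWeakPartial (U : Set Plane) (i : Fin 2) (f g : Plane → ℝ) : Prop :=
  MemLp g 2 (volume.restrict U) ∧
  ∀ φ : Plane → ℝ, ContDiff ℝ ∞ φ → HasCompactSupport φ → tsupport φ ⊆ U →
    ∫ x in U, f x * fderiv ℝ φ x (EuclideanSpace.single i 1) = -∫ x in U, g x * φ x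

/-- `f ∈ H¹(U)`, for an open set `U`. -/
def MemH1 (U : Set Plane) (f : Plane → ℝ) : Prop :=
  MemLp f 2 (volume.restrict U) ∧ ∀ i, ∃ g, IsWeakPartial U i f g

open Classical in
/-- The distributional partial derivative `∂f/∂xᵢ` on `U` (unique up to null sets). -/
noncomputable def weakPartial (U : Set Plane) (i : Fin 2) (f : Plane → ℝ) : Plane → ℝ :=
  if h : ∃ g, IsWeakPartial U i f g then h.choose else 0

/-- The seminorm `|f|_{1,U}` of `H¹(U)`. -/
noncomputable def h1Seminorm (U : Set Plane) (f : Plane → ℝ) : ℝ≥0∞ :=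
  (∑ i : Fin 2, l2Norm U (weakPartial U i f) ^ 2) ^ (1 / 2 : ℝ)

/-- The projection `π_K⁰ f`: the mean value of `f` over `K`. -/
noncomputable def meanProj (K : Set Plane) (f : Plane → ℝ) : ℝ := ⨍ x in K, f x

/-- The piecewise constant projection `π_Ω⁰ f`, equal to `π_K⁰ f` inside each `K ∈ T`. (Its values
on the edges, a null set, are immaterial.) -/
noncomputable def piecewiseMeanProj (T : Finset (Set Plane)) (f : Plane → ℝ) : Plane → ℝ :=
  fun x => ∑ K ∈ T, (interior K).indicator (fun _ => meanProj K f) x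

/-- The supremum of `|v|_{0,K} / |v|_{1,K}` over all `v ∈ H¹(K)` with `∫_K v = 0`, where `0 / 0 = 0`
and `a / 0 = ∞` for `a ≠ 0`. -/
noncomputable def poincareRatio (K : Set Plane) : ℝ≥0∞ :=
  ⨆ (v : Plane → ℝ) (_ : MemH1 (interior K) v) (_ : ∫ x in K, v x = 0),
    l2Norm K v / h1Seminorm (interior K) v

/-!
The constant is `2`. The heart of the matter is the Poincaré inequality on a bounded convex open
set `D`, with a constant that depends on `D` only through its diameter `d`.

For `v` of class `C¹`, the fundamental theorem of calculus on the segment from `y` to `x` and the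
Cauchy–Schwarz inequality give `|v x - v y|² ≤ d² ∫₀¹ |∇v (y + t (x - y))|² dt`. This is integrated
over `D × D`. For `t ≥ 1 / 2` and fixed `y`, the substitution `z = y + t (x - y)` maps `D` into `D`
and costs a factor `t⁻² ≤ 4`; for `t ≤ 1 / 2` the roles of `x` and `y` are exchanged. Hence
`∫∫ |v x - v y|² ≤ 4 d² |D| ∫ |∇v|²` (`Convex.lintegral_lintegral_enorm_sub_sq_le`).

For `f ∈ H¹(D)`, the mollifications of `f` satisfy this on the inner parallel sets of `D`, which
are again convex. There the gradient of the mollification is the mollification of the weak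
gradient, whose `L²` norm is at most that of the weak gradient on `D`. Fatou's lemma carries the
inequality over to `f` (`Convex.lintegral_prod_enorm_sub_sq_le_of_isWeakPartial`). Finally
`∫ |f - m|² ≤ |D|⁻¹ ∫∫ |f x - f y|²` for the mean value `m` of `f`, by Cauchy–Schwarz.

A triangle differs from its convex interior by a null set, which gives the first two claims. For a
triangulation, the open triangles are pairwise disjoint and cover `Ω` up to a null set, and weak
derivatives on `Ω` restrict to weak derivatives on each of them, so the squared inequalities add
up.
-/

open Filter Topology Set Metric
open scoped Convolution

/-! ### Two inequalities for the Lebesgue integral -/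

/-- The Cauchy–Schwarz inequality for a weight `w`. -/
theorem lintegral_mul_sq_le {α : Type*} [MeasurableSpace α] {μ : Measure α} {w u : α → ℝ≥0∞}
    (hw : AEMeasurable w μ) (hu : AEMeasurable u μ) :
    (∫⁻ a, w a * u a ∂μ) ^ 2 ≤ (∫⁻ a, w a ∂μ) * ∫⁻ a, w a * u a ^ 2 ∂μ := by
  have hsq : ∀ x : ℝ≥0∞, (x ^ (1 / 2 : ℝ)) ^ (2 : ℕ) = x := fun x => by
    rw [← ENNReal.rpow_mul_natCast]; norm_num
  have h := ENNReal.lintegral_mul_le_Lp_mul_Lq μ Real.HolderConjugate.two_two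
    (hw.pow_const (1 / 2 : ℝ)) ((hw.pow_const (1 / 2 : ℝ)).mul hu)
  have e1 : ∀ a, ((fun a => w a ^ (1 / 2 : ℝ)) * ((fun a => w a ^ (1 / 2 : ℝ)) * u)) a
      = w a * u a := fun a => by
    simp only [Pi.mul_apply]
    rw [← mul_assoc, ← pow_two, hsq]
  have e2 : ∀ a, (((fun a => w a ^ (1 / 2 : ℝ)) * u) a) ^ (2 : ℝ) = w a * u a ^ 2 := fun a => by
    simp only [Pi.mul_apply]
    rw [ENNReal.rpow_ofNat, mul_pow, hsq]
  have e3 : ∀ a, (w a ^ (1 / 2 : ℝ)) ^ (2 : ℝ) = w a := fun a => by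
    rw [ENNReal.rpow_ofNat, hsq]
  simp only [e1, e2, e3] at h
  calc (∫⁻ a, w a * u a ∂μ) ^ 2 ≤ _ := pow_le_pow_left' h 2
    _ = _ := by rw [mul_pow, hsq, hsq]

section Homothety

variable {E : Type*} [NormedAddCommGroup E] [NormedSpace ℝ E] [MeasurableSpace E] [BorelSpace E]
  [FiniteDimensional ℝ E] (μ : Measure E) [μ.IsAddHaarMeasure]

theorem lintegral_comp_homothety (G : E → ℝ≥0∞) (y : E) {t : ℝ} (ht : 0 < t) :
    ∫⁻ x, G (y + t • (x - y)) ∂μ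
      = ENNReal.ofReal ((t ^ Module.finrank ℝ E)⁻¹) * ∫⁻ x, G x ∂μ := by
  have h1 : ∫⁻ x, G (y + t • (x - y)) ∂μ = ∫⁻ x, G (y + t • x) ∂μ :=
    lintegral_sub_right_eq_self (fun x => G (y + t • x)) y
  have h2 : ∫⁻ x, G (y + t • x) ∂μ = ∫⁻ x, G (y + x) ∂(Measure.map (t • ·) μ) := by
    rw [(measurableEmbedding_const_smul₀ ht.ne').lintegral_map]
  rw [h1, h2, Measure.map_addHaar_smul μ ht.ne', lintegral_smul_measure,
    lintegral_add_left_eq_self, abs_of_pos (by positivity), smul_eq_mul]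

/-- In a convex set, the homothety with ratio `t ≥ 1 / 2` centred at a point of the set increases
integrals at most by the factor `2 ^ dim`. -/
theorem setLIntegral_comp_homothety_le {S : Set E} (hS : Convex ℝ S) (hSm : MeasurableSet S)
    (G : E → ℝ≥0∞) {y : E} (hy : y ∈ S) {t : ℝ} (ht : 1 / 2 ≤ t) (ht1 : t ≤ 1) :
    ∫⁻ x in S, G (y + t • (x - y)) ∂μ ≤ 2 ^ Module.finrank ℝ E * ∫⁻ x in S, G x ∂μ := by
  have ht0 : 0 < t := by linarith
  rw [← lintegral_indicator hSm, ← lintegral_indicator hSm]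
  calc ∫⁻ x, S.indicator (fun x => G (y + t • (x - y))) x ∂μ
      ≤ ∫⁻ x, S.indicator G (y + t • (x - y)) ∂μ := by
        refine lintegral_mono fun x => ?_
        by_cases hx : x ∈ S
        · have : y + t • (x - y) ∈ S := hS.add_smul_sub_mem hy hx ⟨ht0.le, ht1⟩
          simp [hx, this]
        · simp [hx]
    _ = _ := lintegral_comp_homothety μ _ y ht0
    _ ≤ _ := by
        gcongr
        rw [← inv_pow, ENNReal.ofReal_pow (by positivity)]
        gcongr
        rw [show (2 : ℝ≥0∞) = ENNReal.ofReal 2 by simp]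
        apply ENNReal.ofReal_le_ofReal
        rw [inv_le_comm₀ ht0 (by norm_num)]
        linarith

/-- Whichever of `x`, `y` carries the larger weight in `y + t • (x - y)` is taken as the
integration variable, so that the substitution costs a bounded factor for every `t ∈ [0, 1]`. -/
theorem setLIntegral_setLIntegral_comp_segment_le {S : Set E} (hS : Convex ℝ S)
    (hSm : MeasurableSet S) {G : E → ℝ≥0∞} (hG : Measurable G) {t : ℝ} (ht : t ∈ Icc (0 : ℝ) 1) :
    ∫⁻ x in S, ∫⁻ y in S, G (y + t • (x - y)) ∂μ ∂μ
      ≤ 2 ^ Module.finrank ℝ E * μ S * ∫⁻ x in S, G x ∂μ := by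
  have key : ∀ s : ℝ, 1 / 2 ≤ s → s ≤ 1 →
      ∫⁻ y in S, ∫⁻ x in S, G (y + s • (x - y)) ∂μ ∂μ
        ≤ 2 ^ Module.finrank ℝ E * μ S * ∫⁻ x in S, G x ∂μ := by
    intro s hs hs1
    calc ∫⁻ y in S, ∫⁻ x in S, G (y + s • (x - y)) ∂μ ∂μ
        ≤ ∫⁻ y in S, 2 ^ Module.finrank ℝ E * ∫⁻ x in S, G x ∂μ ∂μ :=
          setLIntegral_mono' hSm fun y hy => setLIntegral_comp_homothety_le μ hS hSm G hy hs hs1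
      _ = _ := by rw [setLIntegral_const]; ring
  rcases le_total (1 / 2) t with h | h
  · rw [lintegral_lintegral_swap (by fun_prop)]
    exact key t h ht.2
  · refine le_trans (le_of_eq ?_) (key (1 - t) (by linarith) (by linarith [ht.1]))
    congr! 5 with x y
    module

/-! ### The double integral of a continuously differentiable function -/

/-- The fundamental theorem of calculus along the segment from `y` to `x`, squared. -/
theorem enorm_sub_sq_le_lintegral_fderiv {v : E → ℝ} (hv : ContDiff ℝ 1 v) (x y : E) :
    ‖v x - v y‖ₑ ^ 2 ≤
      edist x y ^ 2 * ∫⁻ t in Icc (0 : ℝ) 1, ‖fderiv ℝ v (y + t • (x - y))‖ₑ ^ 2 := by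
  have hc : Continuous fun t : ℝ => fderiv ℝ v (y + t • (x - y)) :=
    (hv.continuous_fderiv one_ne_zero).comp (by fun_prop)
  have hftc : ∫ t in (0 : ℝ)..1, fderiv ℝ v (y + t • (x - y)) (x - y) = v x - v y := by
    have := intervalIntegral.integral_eq_sub_of_hasDerivAt (a := 0) (b := 1)
      (f := fun t : ℝ => v (y + t • (x - y)))
      (f' := fun t => fderiv ℝ v (y + t • (x - y)) (x - y)) (fun t _ => ?_)
      ((hc.clm_apply continuous_const).intervalIntegrable _ _)
    · simpa using this
    · have h1 : HasDerivAt (fun t : ℝ => y + t • (x - y)) (x - y) t := by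
        simpa using ((hasDerivAt_id t).smul_const (x - y)).const_add y
      exact ((hv.differentiable one_ne_zero _).hasFDerivAt).comp_hasDerivAt t h1
  have hle : ‖v x - v y‖ₑ ≤
      edist x y * ∫⁻ t in Icc (0 : ℝ) 1, ‖fderiv ℝ v (y + t • (x - y))‖ₑ := by
    rw [← hftc, intervalIntegral.integral_of_le zero_le_one, ← integral_Icc_eq_integral_Ioc,
      ← lintegral_const_mul _ (by fun_prop)]
    refine (enorm_integral_le_lintegral_enorm _).trans (lintegral_mono fun t => ?_)
    rw [mul_comm, edist_eq_enorm_sub]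
    exact ContinuousLinearMap.le_opENorm _ _
  have hcs := lintegral_mul_sq_le (μ := volume.restrict (Icc (0 : ℝ) 1)) (w := fun _ => 1)
    (u := fun t => ‖fderiv ℝ v (y + t • (x - y))‖ₑ) aemeasurable_const (by fun_prop)
  simp only [one_mul, lintegral_const, Measure.restrict_apply_univ, Real.volume_Icc, sub_zero,
    ENNReal.ofReal_one] at hcs
  calc ‖v x - v y‖ₑ ^ 2 ≤ _ := pow_le_pow_left' hle 2
    _ ≤ _ := by rw [mul_pow]; gcongr

theorem Convex.lintegral_lintegral_enorm_sub_sq_le {S : Set E} (hS : Convex ℝ S)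
    (hSm : MeasurableSet S) {v : E → ℝ} (hv : ContDiff ℝ 1 v) :
    ∫⁻ x in S, ∫⁻ y in S, ‖v x - v y‖ₑ ^ 2 ∂μ ∂μ ≤
      2 ^ Module.finrank ℝ E * μ S * ediam S ^ 2 * ∫⁻ x in S, ‖fderiv ℝ v x‖ₑ ^ 2 ∂μ := by
  have hc : Continuous (fderiv ℝ v) := hv.continuous_fderiv one_ne_zero
  have hm : Measurable fun x => ‖fderiv ℝ v x‖ₑ ^ 2 := by fun_prop
  calc ∫⁻ x in S, ∫⁻ y in S, ‖v x - v y‖ₑ ^ 2 ∂μ ∂μ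
      ≤ ∫⁻ x in S, ∫⁻ y in S, ediam S ^ 2 *
          (∫⁻ t in Icc (0 : ℝ) 1, ‖fderiv ℝ v (y + t • (x - y))‖ₑ ^ 2) ∂μ ∂μ := by
        refine setLIntegral_mono' hSm fun x hx => setLIntegral_mono' hSm fun y hy => ?_
        refine (enorm_sub_sq_le_lintegral_fderiv hv x y).trans ?_
        gcongr
        exact edist_le_ediam_of_mem hx hy
    _ = ediam S ^ 2 * ∫⁻ t in Icc (0 : ℝ) 1, ∫⁻ x in S, ∫⁻ y in S,
          ‖fderiv ℝ v (y + t • (x - y))‖ₑ ^ 2 ∂μ ∂μ := by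
        have e1 : ∀ x, ∫⁻ y in S, ediam S ^ 2 *
            (∫⁻ t in Icc (0 : ℝ) 1, ‖fderiv ℝ v (y + t • (x - y))‖ₑ ^ 2) ∂μ
            = ediam S ^ 2 * ∫⁻ t in Icc (0 : ℝ) 1, ∫⁻ y in S,
              ‖fderiv ℝ v (y + t • (x - y))‖ₑ ^ 2 ∂μ := fun x => by
          have hmx : Measurable (Function.uncurry fun (y : E) (t : ℝ) =>
              ‖fderiv ℝ v (y + t • (x - y))‖ₑ ^ 2) :=
            hm.comp (g := fun z => ‖fderiv ℝ v z‖ₑ ^ 2)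
              (f := fun p : E × ℝ => p.1 + p.2 • (x - p.1)) (by fun_prop)
          rw [lintegral_const_mul _ hmx.lintegral_prod_right,
            lintegral_lintegral_swap hmx.aemeasurable]
        have hmt : Measurable (Function.uncurry fun (x : E) (t : ℝ) =>
            ∫⁻ y in S, ‖fderiv ℝ v (y + t • (x - y))‖ₑ ^ 2 ∂μ) :=
          Measurable.lintegral_prod_right' (f := fun p : (E × ℝ) × E =>
              ‖fderiv ℝ v (p.2 + p.1.2 • (p.1.1 - p.2))‖ₑ ^ 2)
            (hm.comp (g := fun z => ‖fderiv ℝ v z‖ₑ ^ 2)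
              (f := fun p : (E × ℝ) × E => p.2 + p.1.2 • (p.1.1 - p.2)) (by fun_prop))
        simp_rw [e1]
        rw [lintegral_const_mul _ hmt.lintegral_prod_right,
          lintegral_lintegral_swap hmt.aemeasurable]
    _ ≤ ediam S ^ 2 * ∫⁻ t in Icc (0 : ℝ) 1,
          2 ^ Module.finrank ℝ E * μ S * ∫⁻ x in S, ‖fderiv ℝ v x‖ₑ ^ 2 ∂μ := by
        gcongr ediam S ^ 2 * ?_
        exact setLIntegral_mono' measurableSet_Icc fun t ht =>
          setLIntegral_setLIntegral_comp_segment_le μ hS hSm hm ht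
    _ = _ := by
        rw [setLIntegral_const, Real.volume_Icc]
        simp only [sub_zero, ENNReal.ofReal_one, mul_one]
        ring

end Homothety

/-! ### Mollification of functions in `H¹` -/

/-- Averaging against a normalized bump function does not increase the `L²` norm. -/
theorem ContDiffBump.lintegral_enorm_convolution_sq_le {E : Type*} [NormedAddCommGroup E]
    [InnerProductSpace ℝ E] [MeasurableSpace E] [BorelSpace E] [FiniteDimensional ℝ E]
    (μ : Measure E) [μ.IsAddHaarMeasure] (φ : ContDiffBump (0 : E)) {G : E → ℝ}
    (hG : AEStronglyMeasurable G μ) :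
    ∫⁻ x, ‖(φ.normed μ ⋆[ContinuousLinearMap.lsmul ℝ ℝ, μ] G) x‖ₑ ^ 2 ∂μ
      ≤ ∫⁻ x, ‖G x‖ₑ ^ 2 ∂μ := by
  have hφc : Continuous (φ.normed μ) := φ.continuous_normed
  have hmass : ∫⁻ t, ‖φ.normed μ t‖ₑ ∂μ = 1 := by
    have := ofReal_integral_eq_lintegral_ofReal (φ.integrable_normed (μ := μ))
      (ae_of_all _ φ.nonneg_normed)
    rw [φ.integral_normed, ENNReal.ofReal_one] at this
    rw [this]
    exact lintegral_congr fun t => Real.enorm_of_nonneg (φ.nonneg_normed t)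
  have hcomp : ∀ x, AEStronglyMeasurable (fun t => G (x - t)) μ := fun x =>
    hG.comp_quasiMeasurePreserving (quasiMeasurePreserving_sub_left_of_right_invariant μ x)
  have hprod : AEMeasurable (Function.uncurry fun x t => ‖φ.normed μ t‖ₑ * ‖G (x - t)‖ₑ ^ 2)
      (μ.prod μ) := by
    have h1 : AEStronglyMeasurable (fun p : E × E => G (p.1 - p.2)) (μ.prod μ) :=
      hG.comp_quasiMeasurePreserving (quasiMeasurePreserving_sub μ μ)
    have h2 : AEMeasurable (fun p : E × E => ‖φ.normed μ p.2‖ₑ) (μ.prod μ) := by fun_prop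
    exact h2.mul (h1.enorm.pow_const 2)
  calc ∫⁻ x, ‖(φ.normed μ ⋆[ContinuousLinearMap.lsmul ℝ ℝ, μ] G) x‖ₑ ^ 2 ∂μ
      ≤ ∫⁻ x, ∫⁻ t, ‖φ.normed μ t‖ₑ * ‖G (x - t)‖ₑ ^ 2 ∂μ ∂μ := by
        refine lintegral_mono fun x => ?_
        calc ‖(φ.normed μ ⋆[ContinuousLinearMap.lsmul ℝ ℝ, μ] G) x‖ₑ ^ 2
            ≤ (∫⁻ t, ‖φ.normed μ t‖ₑ * ‖G (x - t)‖ₑ ∂μ) ^ 2 := by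
              gcongr
              refine (enorm_integral_le_lintegral_enorm _).trans_eq (lintegral_congr fun t => ?_)
              simp [enorm_mul]
          _ ≤ _ := lintegral_mul_sq_le (by fun_prop) (hcomp x).enorm
          _ = _ := by rw [hmass, one_mul]
    _ = ∫⁻ t, ‖φ.normed μ t‖ₑ * ∫⁻ x, ‖G (x - t)‖ₑ ^ 2 ∂μ ∂μ := by
        rw [lintegral_lintegral_swap hprod]
        exact lintegral_congr fun t => lintegral_const_mul' _ _ enorm_ne_top
    _ = ∫⁻ x, ‖G x‖ₑ ^ 2 ∂μ := by
        have : ∀ t, ∫⁻ x, ‖G (x - t)‖ₑ ^ 2 ∂μ = ∫⁻ x, ‖G x‖ₑ ^ 2 ∂μ :=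
          fun t => lintegral_sub_right_eq_self (fun x => ‖G x‖ₑ ^ 2) t
        simp_rw [this]
        rw [lintegral_mul_const _ (by fun_prop), hmass, one_mul]

/-- The mollification of the extension of `f` by zero outside `U`. -/
noncomputable def mollify (φ : ContDiffBump (0 : Plane)) (U : Set Plane) (f : Plane → ℝ) :
    Plane → ℝ :=
  φ.normed volume ⋆[ContinuousLinearMap.lsmul ℝ ℝ, volume] U.indicator f

theorem mollify_eq_flip (φ : ContDiffBump (0 : Plane)) (U : Set Plane) (f : Plane → ℝ) :
    mollify φ U f =
      U.indicator f ⋆[(ContinuousLinearMap.lsmul ℝ ℝ).flip, volume] φ.normed volume :=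
  (convolution_flip _).symm

theorem mollify_apply (φ : ContDiffBump (0 : Plane)) {U : Set Plane} (hU : MeasurableSet U)
    (f : Plane → ℝ) (x : Plane) :
    mollify φ U f x = ∫ t in U, f t * φ.normed volume (x - t) := by
  rw [mollify_eq_flip, convolution_def, ← integral_indicator hU]
  refine integral_congr_ae (ae_of_all _ fun t => ?_)
  by_cases ht : t ∈ U <;> simp [ht, mul_comm]

theorem MeasureTheory.MemLp.locallyIntegrable_indicator {U : Set Plane} (hU : MeasurableSet U)
    {f : Plane → ℝ} (hf : MemLp f 2 (volume.restrict U)) : LocallyIntegrable (U.indicator f) :=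
  ((memLp_indicator_iff_restrict hU).2 hf).locallyIntegrable one_le_two

theorem contDiff_mollify (φ : ContDiffBump (0 : Plane)) {U : Set Plane} (hU : MeasurableSet U)
    {f : Plane → ℝ} (hf : MemLp f 2 (volume.restrict U)) : ContDiff ℝ 1 (mollify φ U f) :=
  φ.hasCompactSupport_normed.contDiff_convolution_left (n := 1) _ φ.contDiff_normed
    (hf.locallyIntegrable_indicator hU)

theorem lintegral_enorm_mollify_sq_le (φ : ContDiffBump (0 : Plane)) {U : Set Plane}
    (hU : MeasurableSet U) {f : Plane → ℝ} (hf : MemLp f 2 (volume.restrict U)) :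
    ∫⁻ x, ‖mollify φ U f x‖ₑ ^ 2 ≤ ∫⁻ x in U, ‖f x‖ₑ ^ 2 := by
  refine (φ.lintegral_enorm_convolution_sq_le volume
    ((memLp_indicator_iff_restrict hU).2 hf).aestronglyMeasurable).trans_eq ?_
  rw [← lintegral_indicator hU]
  refine lintegral_congr fun x => ?_
  by_cases hx : x ∈ U <;> simp [hx]

/-- At points whose distance to the complement of `U` is larger than the radius of the mollifier,
the translated mollifier is a test function on `U`, so that mollification commutes with taking
weak derivatives. -/
theorem IsWeakPartial.fderiv_mollify {U : Set Plane} (hU : MeasurableSet U) {i : Fin 2}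
    {f g : Plane → ℝ} (hf : MemLp f 2 (volume.restrict U)) (h : IsWeakPartial U i f g)
    (φ : ContDiffBump (0 : Plane)) {x : Plane} (hx : closedBall x φ.rOut ⊆ U) :
    fderiv ℝ (mollify φ U f) x (EuclideanSpace.single i 1) = mollify φ U g x := by
  have hφ : ContDiff ℝ ∞ (φ.normed volume : Plane → ℝ) := φ.contDiff_normed
  set ψ : Plane → ℝ := fun y => φ.normed volume (x - y) with hψ
  have hψd : ContDiff ℝ ∞ ψ := hφ.comp (contDiff_const.sub contDiff_id)
  have hψs : tsupport ψ ⊆ closedBall x φ.rOut := by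
    refine closure_minimal (fun y hy => ?_) isClosed_closedBall
    have : x - y ∈ Function.support (φ.normed volume : Plane → ℝ) := hy
    rw [φ.support_normed_eq, mem_ball_zero_iff] at this
    rw [mem_closedBall, dist_comm, dist_eq_norm]
    exact this.le
  have hψc : HasCompactSupport ψ :=
    (isCompact_closedBall x φ.rOut).of_isClosed_subset (isClosed_tsupport ψ) hψs
  have hψ' : ∀ y w, fderiv ℝ ψ y w = -fderiv ℝ (φ.normed volume : Plane → ℝ) (x - y) w := by
    intro y w
    have h1 : HasFDerivAt (fun y : Plane => x - y) (-ContinuousLinearMap.id ℝ Plane) y :=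
      (hasFDerivAt_id y).const_sub x
    have h2 := ((hφ.differentiable (by simp) (x - y)).hasFDerivAt.comp y h1).fderiv
    change fderiv ℝ (φ.normed volume ∘ fun y : Plane => x - y) y w = _
    rw [h2]
    simp
  have hloc := hf.locallyIntegrable_indicator hU
  rw [mollify_eq_flip, (φ.hasCompactSupport_normed.hasFDerivAt_convolution_right _ hloc
    (hφ.of_le (by simp)) x).fderiv,
    convolution_precompR_apply _ hloc (φ.hasCompactSupport_normed.fderiv ℝ)
      (hφ.continuous_fderiv (by simp)), convolution_def, mollify_apply φ hU]
  calc _ = ∫ t in U, f t *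
        fderiv ℝ (φ.normed volume : Plane → ℝ) (x - t) (EuclideanSpace.single i 1) := by
        rw [← integral_indicator hU]
        refine integral_congr_ae (ae_of_all _ fun t => ?_)
        by_cases ht : t ∈ U <;> simp [ht, mul_comm]
    _ = -∫ t in U, f t * fderiv ℝ ψ t (EuclideanSpace.single i 1) := by
        simp_rw [hψ', mul_neg, integral_neg, neg_neg]
    _ = ∫ t in U, g t * ψ t := by rw [h.2 ψ hψd hψc (hψs.trans hx), neg_neg]

/-- The operator norm of a functional on the plane is bounded by the Euclidean norm of its
components. -/
theorem enorm_sq_le_sum_apply_single (L : Plane →L[ℝ] ℝ) :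
    ‖L‖ₑ ^ 2 ≤ ∑ i : Fin 2, ‖L (EuclideanSpace.single i 1)‖ₑ ^ 2 := by
  set a := L (EuclideanSpace.single 0 1)
  set b := L (EuclideanSpace.single 1 1)
  have hL : ‖L‖ ≤ √(a ^ 2 + b ^ 2) := by
    refine L.opNorm_le_bound (Real.sqrt_nonneg _) fun x => ?_
    have hx : L x = x 0 * a + x 1 * b := by
      have : x = x 0 • EuclideanSpace.single 0 (1 : ℝ) + x 1 • EuclideanSpace.single 1 (1 : ℝ) := by
        ext j; fin_cases j <;> simp
      conv_lhs => rw [this]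
      simp [a, b]
    rw [EuclideanSpace.norm_eq, ← Real.sqrt_mul (by positivity), hx, Real.norm_eq_abs]
    apply Real.abs_le_sqrt
    simp only [Fin.sum_univ_two, Real.norm_eq_abs, sq_abs]
    nlinarith [sq_nonneg (x 0 * b - x 1 * a)]
  have hL2 : ‖L‖ ^ 2 ≤ a ^ 2 + b ^ 2 := by
    calc ‖L‖ ^ 2 ≤ √(a ^ 2 + b ^ 2) ^ 2 := by gcongr
      _ = _ := Real.sq_sqrt (by positivity)
  rw [Fin.sum_univ_two]
  change _ ≤ ‖a‖ₑ ^ 2 + ‖b‖ₑ ^ 2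
  simp only [← ofReal_norm, ← ENNReal.ofReal_pow (norm_nonneg _)]
  rw [← ENNReal.ofReal_add (by positivity) (by positivity)]
  exact ENNReal.ofReal_le_ofReal (by simpa using hL2)

/-! ### The Poincaré inequality on bounded open convex sets -/

theorem mem_compl_thickening_compl {X : Type*} [PseudoMetricSpace X] {U : Set X} {δ : ℝ} {x : X} :
    x ∈ (Metric.thickening δ Uᶜ)ᶜ ↔ ball x δ ⊆ U := by
  rw [mem_compl_iff, mem_thickening_iff]
  push Not
  refine ⟨fun h z hz => ?_, fun h z hz => ?_⟩
  · by_contra hzU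
    exact absurd (mem_ball'.1 hz) (not_lt.2 (h z hzU))
  · by_contra hlt
    exact hz (h (mem_ball'.2 (not_le.1 hlt)))

/-- The inner parallel sets of a convex set are convex. -/
theorem Convex.compl_thickening_compl {E : Type*} [NormedAddCommGroup E] [NormedSpace ℝ E]
    {U : Set E} (hU : Convex ℝ U) (δ : ℝ) : Convex ℝ (Metric.thickening δ Uᶜ)ᶜ := by
  intro x hx y hy a b ha hb hab
  rw [mem_compl_thickening_compl] at hx hy ⊢
  intro z hz
  set w := z - (a • x + b • y) with hw
  have hwn : ‖w‖ < δ := by rwa [mem_ball, dist_eq_norm] at hz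
  have hz' : z = a • (x + w) + b • (y + w) := by
    have : a • (x + w) + b • (y + w) = a • x + b • y + (a + b) • w := by module
    rw [this, hab, one_smul, hw]
    abel
  rw [hz']
  exact hU (hx (by simpa [mem_ball, dist_eq_norm] using hwn))
    (hy (by simpa [mem_ball, dist_eq_norm] using hwn)) ha hb hab

/-- The double integral inequality passes from smooth functions to `H¹`: it is applied to
mollifications on inner parallel sets of `D`, which exhaust `D`, and Fatou's lemma yields the
limit. -/
theorem Convex.lintegral_prod_enorm_sub_sq_le_of_isWeakPartial {D : Set Plane} (hD : Convex ℝ D)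
    (hDo : IsOpen D) {f : Plane → ℝ} {g : Fin 2 → Plane → ℝ}
    (hf : MemLp f 2 (volume.restrict D)) (hg : ∀ i, IsWeakPartial D i f (g i)) :
    ∫⁻ p in D ×ˢ D, ‖f p.1 - f p.2‖ₑ ^ 2 ∂(volume.prod volume) ≤
      4 * volume D * ediam D ^ 2 * ∑ i, ∫⁻ x in D, ‖g i x‖ₑ ^ 2 := by
  have hDm := hDo.measurableSet
  set δ : ℕ → ℝ := fun n => 1 / ((n : ℝ) + 1) with hδ
  have hδpos : ∀ n, 0 < δ n := fun n => Nat.one_div_pos_of_nat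
  have hδ0 : Tendsto δ atTop (𝓝 0) := tendsto_one_div_add_atTop_nhds_zero_nat
  -- The outer radius is less than `δ n`, so that even the closed supporting ball around a point of
  -- the inner parallel set lies in `D`; the ratio of the radii is fixed, as needed for
  -- convergence almost everywhere.
  let φ : ℕ → ContDiffBump (0 : Plane) := fun n =>
    ⟨δ n / 4, δ n / 2, by linarith [hδpos n], by linarith [hδpos n]⟩
  set S : ℕ → Set Plane := fun n => (Metric.thickening (δ n) Dᶜ)ᶜ with hS
  have hSm : ∀ n, MeasurableSet (S n) := fun n => isOpen_thickening.measurableSet.compl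
  have hball : ∀ n, ∀ x ∈ S n, closedBall x (φ n).rOut ⊆ D := fun n x hx =>
    (closedBall_subset_ball (show δ n / 2 < δ n by linarith [hδpos n])).trans
      (mem_compl_thickening_compl.1 hx)
  have hSD : ∀ n, S n ⊆ D := fun n x hx =>
    hball n x hx (mem_closedBall_self (φ n).rOut_pos.le)
  have hexh : ∀ x ∈ D, ∀ᶠ n in atTop, x ∈ S n := by
    intro x hx
    obtain ⟨ε, hε, hεD⟩ := isOpen_iff.1 hDo x hx
    filter_upwards [hδ0.eventually (gt_mem_nhds hε)] with n hn
    exact mem_compl_thickening_compl.2 ((ball_subset_ball hn.le).trans hεD)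
  set v : ℕ → Plane → ℝ := fun n => mollify (φ n) D f with hv
  have hvs : ∀ n, ContDiff ℝ 1 (v n) := fun n => contDiff_mollify (φ n) hDm hf
  have hvlim : ∀ᵐ x : Plane, Tendsto (fun n => v n x) atTop (𝓝 (D.indicator f x)) :=
    ContDiffBump.ae_convolution_tendsto_right_of_locallyIntegrable (K := 2)
      (by simpa using hδ0.div_const 2)
      (Eventually.of_forall fun n => (show δ n / 2 ≤ 2 * (δ n / 4) by linarith))
      (hf.locallyIntegrable_indicator hDm)
  set F : ℕ → Plane × Plane → ℝ≥0∞ := fun n =>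
    (S n ×ˢ S n).indicator fun p => ‖v n p.1 - v n p.2‖ₑ ^ 2 with hF
  have hFm' : ∀ n, Measurable fun p : Plane × Plane => ‖v n p.1 - v n p.2‖ₑ ^ 2 := fun n => by
    have := (hvs n).continuous
    fun_prop
  have hFm : ∀ n, Measurable (F n) := fun n => (hFm' n).indicator ((hSm n).prod (hSm n))
  have hFle : ∀ n, ∫⁻ p, F n p ∂(volume.prod volume) ≤
      4 * volume D * ediam D ^ 2 * ∑ i, ∫⁻ x in D, ‖g i x‖ₑ ^ 2 := by
    intro n
    have hgrad : ∫⁻ x in S n, ‖fderiv ℝ (v n) x‖ₑ ^ 2 ≤ ∑ i, ∫⁻ x in D, ‖g i x‖ₑ ^ 2 := by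
      have hgm : ∀ i, Measurable fun x => ‖mollify (φ n) D (g i) x‖ₑ ^ 2 := fun i => by
        have := (contDiff_mollify (φ n) hDm (hg i).1).continuous
        fun_prop
      calc ∫⁻ x in S n, ‖fderiv ℝ (v n) x‖ₑ ^ 2
          ≤ ∫⁻ x in S n, ∑ i, ‖mollify (φ n) D (g i) x‖ₑ ^ 2 := by
            refine setLIntegral_mono' (hSm n) fun x hx => ?_
            refine (enorm_sq_le_sum_apply_single _).trans_eq ?_
            refine Finset.sum_congr rfl fun i _ => ?_
            rw [hv, (hg i).fderiv_mollify hDm hf (φ n) (hball n x hx)]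
        _ = ∑ i, ∫⁻ x in S n, ‖mollify (φ n) D (g i) x‖ₑ ^ 2 :=
            lintegral_finsetSum _ fun i _ => hgm i
        _ ≤ _ := Finset.sum_le_sum fun i _ => (setLIntegral_le_lintegral _ _).trans
            (lintegral_enorm_mollify_sq_le (φ n) hDm (hg i).1)
    calc ∫⁻ p, F n p ∂(volume.prod volume)
        = ∫⁻ x in S n, ∫⁻ y in S n, ‖v n x - v n y‖ₑ ^ 2 := by
          rw [lintegral_indicator ((hSm n).prod (hSm n)), ← Measure.prod_restrict,
            lintegral_prod _ (hFm' n).aemeasurable]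
      _ ≤ _ := (hD.compl_thickening_compl (δ n)).lintegral_lintegral_enorm_sub_sq_le volume
          (hSm n) (hvs n)
      _ ≤ 2 ^ Module.finrank ℝ Plane * volume D * ediam D ^ 2 *
            ∑ i, ∫⁻ x in D, ‖g i x‖ₑ ^ 2 :=
          mul_le_mul' (mul_le_mul' (mul_le_mul' le_rfl (measure_mono (hSD n)))
            (pow_le_pow_left' (ediam_mono (hSD n)) 2)) hgrad
      _ = _ := by
          rw [finrank_euclideanSpace_fin]
          norm_num
  rw [← lintegral_indicator (hDm.prod hDm)]
  calc _ ≤ ∫⁻ p, liminf (fun n => F n p) atTop ∂(volume.prod volume) := by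
        refine lintegral_mono_ae ?_
        filter_upwards [Measure.quasiMeasurePreserving_fst.ae hvlim,
          Measure.quasiMeasurePreserving_snd.ae hvlim] with p h1 h2
        by_cases hp : p ∈ D ×ˢ D
        · rw [indicator_of_mem hp]
          rw [indicator_of_mem hp.1] at h1
          rw [indicator_of_mem hp.2] at h2
          have hlim : Tendsto (fun n => F n p) atTop (𝓝 (‖f p.1 - f p.2‖ₑ ^ 2)) := by
            refine Tendsto.congr' ?_ (ENNReal.Tendsto.pow (n := 2) (h1.sub h2).enorm)
            filter_upwards [hexh _ hp.1, hexh _ hp.2] with n hn1 hn2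
            have hpn : p ∈ S n ×ˢ S n := ⟨hn1, hn2⟩
            simp only [hF, indicator_of_mem hpn]
          exact hlim.liminf_eq.ge
        · simp [hp]
    _ ≤ liminf (fun n => ∫⁻ p, F n p ∂(volume.prod volume)) atTop := lintegral_liminf_le hFm
    _ ≤ _ := liminf_le_of_le (h := fun b hb => by
        obtain ⟨n, hn⟩ := hb.exists
        exact hn.trans (hFle n))

/-- Cauchy–Schwarz for the probability measure `(μ univ)⁻¹ • μ`, as
`f x - ⨍ f` is the mean over `y` of `f x - f y`. -/
theorem lintegral_enorm_sub_average_sq_le {α : Type*} [MeasurableSpace α] {μ : Measure α}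
    [IsFiniteMeasure μ] {f : α → ℝ} (hf : Integrable f μ) :
    ∫⁻ x, ‖f x - ⨍ y, f y ∂μ‖ₑ ^ 2 ∂μ ≤
      (μ univ)⁻¹ * ∫⁻ x, ∫⁻ y, ‖f x - f y‖ₑ ^ 2 ∂μ ∂μ := by
  rcases eq_zero_or_neZero μ with rfl | hμ
  · simp
  have hinv : (μ univ)⁻¹ ≠ ⊤ := ENNReal.inv_ne_top.2 (NeZero.ne _)
  rw [← lintegral_const_mul' _ _ hinv]
  refine lintegral_mono fun x => ?_
  have h1 : f x - ⨍ y, f y ∂μ = ⨍ y, (f x - f y) ∂μ := by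
    rw [average, average, integral_sub (integrable_const _) (hf.smul_measure hinv)]
    simp
  calc ‖f x - ⨍ y, f y ∂μ‖ₑ ^ 2
      ≤ (∫⁻ y, 1 * ‖f x - f y‖ₑ ∂((μ univ)⁻¹ • μ)) ^ 2 := by
        rw [h1, average]
        simp_rw [one_mul]
        gcongr
        exact enorm_integral_le_lintegral_enorm _
    _ ≤ _ := lintegral_mul_sq_le aemeasurable_const
        (hf.1.aemeasurable.const_sub _ |>.smul_measure _ |>.enorm)
    _ = _ := by
        simp [lintegral_smul_measure]

theorem l2Norm_sq (S : Set Plane) (f : Plane → ℝ) : l2Norm S f ^ 2 = ∫⁻ x in S, ‖f x‖ₑ ^ 2 := by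
  rw [l2Norm, eLpNorm_eq_lintegral_rpow_enorm_toReal two_ne_zero ENNReal.ofNat_ne_top,
    ← ENNReal.rpow_mul_natCast]
  simp

/-- The Poincaré inequality on a bounded convex open set, for any choice `g` of the weak
derivatives. -/
theorem Convex.l2Norm_sub_meanProj_sq_le {D : Set Plane} (hD : Convex ℝ D) (hDo : IsOpen D)
    (hDb : Bornology.IsBounded D) {f : Plane → ℝ} {g : Fin 2 → Plane → ℝ}
    (hf : MemLp f 2 (volume.restrict D)) (hg : ∀ i, IsWeakPartial D i f (g i)) :
    l2Norm D (fun x => f x - meanProj D f) ^ 2 ≤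
      (2 * ediam D) ^ 2 * ∑ i, l2Norm D (g i) ^ 2 := by
  rcases D.eq_empty_or_nonempty with rfl | hne
  · simp [l2Norm]
  have hfin : volume D ≠ ⊤ := hDb.measure_lt_top.ne
  have hpos : volume D ≠ 0 := (hDo.measure_pos volume hne).ne'
  have : IsFiniteMeasure (volume.restrict D) := ⟨by simpa using hDb.measure_lt_top⟩
  have hmeas : AEMeasurable (fun p : Plane × Plane => ‖f p.1 - f p.2‖ₑ ^ 2)
      ((volume.restrict D).prod (volume.restrict D)) :=
    ((hf.1.comp_fst.sub hf.1.comp_snd).enorm).pow_const 2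
  simp_rw [l2Norm_sq]
  calc _ ≤ (volume D)⁻¹ * ∫⁻ x in D, ∫⁻ y in D, ‖f x - f y‖ₑ ^ 2 := by
        simpa [meanProj] using lintegral_enorm_sub_average_sq_le (hf.integrable one_le_two)
    _ = (volume D)⁻¹ * ∫⁻ p in D ×ˢ D, ‖f p.1 - f p.2‖ₑ ^ 2 ∂(volume.prod volume) := by
        rw [← Measure.prod_restrict, lintegral_prod _ hmeas]
    _ ≤ (volume D)⁻¹ * (4 * volume D * ediam D ^ 2 * ∑ i, ∫⁻ x in D, ‖g i x‖ₑ ^ 2) := by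
        gcongr
        exact hD.lintegral_prod_enorm_sub_sq_le_of_isWeakPartial hDo hf hg
    _ = ((volume D)⁻¹ * volume D) * ((2 * ediam D) ^ 2 * ∑ i, ∫⁻ x in D, ‖g i x‖ₑ ^ 2) := by
        ring
    _ = _ := by rw [ENNReal.inv_mul_cancel hpos hfin, one_mul]

/-! ### Triangles and triangulations -/

theorem IsTriangle.convex {K : Set Plane} (hK : IsTriangle K) : Convex ℝ K := by
  obtain ⟨p, -, rfl⟩ := hK
  exact convex_convexHull ℝ _

theorem IsTriangle.isBounded {K : Set Plane} (hK : IsTriangle K) : Bornology.IsBounded K := by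
  obtain ⟨p, -, rfl⟩ := hK
  exact isBounded_convexHull.2 (finite_range p).isBounded

theorem Convex.restrict_interior {K : Set Plane} (hK : Convex ℝ K) :
    (volume : Measure Plane).restrict (interior K) = volume.restrict K :=
  Measure.restrict_congr_set (interior_ae_eq_of_null_frontier (hK.addHaar_frontier volume))

/-- The Poincaré inequality on a triangle, for any choice `g` of the weak derivatives. -/
theorem IsTriangle.l2Norm_interior_sub_meanProj_sq_le {K : Set Plane} (hK : IsTriangle K)
    {f : Plane → ℝ} {g : Fin 2 → Plane → ℝ} (hf : MemLp f 2 (volume.restrict (interior K)))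
    (hg : ∀ i, IsWeakPartial (interior K) i f (g i)) :
    l2Norm (interior K) (fun x => f x - meanProj K f) ^ 2 ≤
      (2 * ediam K) ^ 2 * ∑ i, l2Norm (interior K) (g i) ^ 2 := by
  have hmean : meanProj K f = meanProj (interior K) f := by
    rw [meanProj, meanProj, hK.convex.restrict_interior]
  rw [hmean]
  refine (hK.convex.interior.l2Norm_sub_meanProj_sq_le isOpen_interior
    (hK.isBounded.subset interior_subset) hf hg).trans ?_
  gcongr
  exact interior_subset

theorem MemH1.isWeakPartial_weakPartial {U : Set Plane} {f : Plane → ℝ} (hf : MemH1 U f)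
    (i : Fin 2) : IsWeakPartial U i f (weakPartial U i f) := by
  rw [weakPartial, dif_pos (hf.2 i)]
  exact (hf.2 i).choose_spec

theorem h1Seminorm_sq (U : Set Plane) (f : Plane → ℝ) :
    h1Seminorm U f ^ 2 = ∑ i : Fin 2, l2Norm U (weakPartial U i f) ^ 2 := by
  rw [h1Seminorm, ← ENNReal.rpow_mul_natCast]
  norm_num

theorem IsTriangle.l2Norm_sub_meanProj_le {K : Set Plane} (hK : IsTriangle K) {f : Plane → ℝ}
    (hf : MemH1 (interior K) f) :
    l2Norm K (fun x => f x - meanProj K f) ≤ 2 * ediam K * h1Seminorm (interior K) f := by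
  rw [← ENNReal.pow_le_pow_left_iff two_ne_zero, mul_pow, h1Seminorm_sq]
  have : l2Norm K (fun x => f x - meanProj K f)
      = l2Norm (interior K) (fun x => f x - meanProj K f) := by
    rw [l2Norm, l2Norm, hK.convex.restrict_interior]
  rw [this]
  exact hK.l2Norm_interior_sub_meanProj_sq_le hf.1 hf.isWeakPartial_weakPartial

theorem IsWeakPartial.mono {U V : Set Plane} (hUV : U ⊆ V) (hV : MeasurableSet V) {i : Fin 2}
    {f g : Plane → ℝ} (h : IsWeakPartial V i f g) : IsWeakPartial U i f g := by
  refine ⟨h.1.mono_measure (Measure.restrict_mono hUV le_rfl), fun φ hφ hφc hφU => ?_⟩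
  have hzero : ∀ x ∉ U, φ x = 0 := fun x hx => image_eq_zero_of_notMem_tsupport (mt (@hφU x) hx)
  have hzero' : ∀ x ∉ U, fderiv ℝ φ x = 0 := fun x hx =>
    image_eq_zero_of_notMem_tsupport (mt (fun hx => hφU (tsupport_fderiv_subset ℝ hx)) hx)
  rw [← setIntegral_eq_of_subset_of_forall_sdiff_eq_zero hV hUV
      (f := fun x => f x * fderiv ℝ φ x (EuclideanSpace.single i 1))
      (fun x hx => by simp [hzero' x hx.2]),
    ← setIntegral_eq_of_subset_of_forall_sdiff_eq_zero hV hUV (f := fun x => g x * φ x)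
      (fun x hx => by simp [hzero x hx.2])]
  exact h.2 φ hφ hφc (hφU.trans hUV)

theorem volume_segment_eq_zero (a b : Plane) : volume (segment ℝ a b) = 0 := by
  refine measure_mono_null (t := (line[ℝ, a, b] : Set Plane)) ?_
    (Measure.addHaar_affineSubspace _ _ fun htop => ?_)
  · rw [segment_eq_image_lineMap]
    rintro _ ⟨t, -, rfl⟩
    exact AffineMap.lineMap_mem_affineSpan_pair t a b
  · -- A line cannot be the whole plane, as its dimension is at most one.
    have h1 : Module.finrank ℝ (line[ℝ, a, b]).direction ≤ 1 :=
      (collinear_iff_finrank_le_one.1 (collinear_pair ℝ a b)) |> fun h => by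
        rwa [direction_affineSpan]
    rw [htop, AffineSubspace.direction_top, finrank_top, finrank_euclideanSpace_fin] at h1
    omega

/-- Two different triangles of a triangulation meet at most in a null set, which has no
interior points. -/
theorem IsProperTriangulation.disjoint_interior {Ω : Set Plane} {T : Finset (Set Plane)}
    (hT : IsProperTriangulation Ω T) {K₁ K₂ : Set Plane} (h₁ : K₁ ∈ T) (h₂ : K₂ ∈ T)
    (hne : K₁ ≠ K₂) : Disjoint (interior K₁) (interior K₂) := by
  have hnull : volume (K₁ ∩ K₂) = 0 := by
    rcases hT.face_to_face K₁ h₁ K₂ h₂ hne with h | ⟨x, -, -, h⟩ | ⟨e, ⟨p, -, i, j, -, he⟩, -, h⟩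
    · rw [h, measure_empty]
    · rw [h, measure_singleton]
    · rw [h, he, volume_segment_eq_zero]
  rw [disjoint_iff_inter_eq_empty, ← interior_inter]
  exact Measure.interior_eq_empty_of_null hnull

theorem IsProperTriangulation.piecewiseMeanProj_eq {Ω : Set Plane} {T : Finset (Set Plane)}
    (hT : IsProperTriangulation Ω T) (f : Plane → ℝ) {K : Set Plane} (hK : K ∈ T) {x : Plane}
    (hx : x ∈ interior K) : piecewiseMeanProj T f x = meanProj K f := by
  rw [piecewiseMeanProj, Finset.sum_eq_single_of_mem K hK, indicator_of_mem hx]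
  intro K' hK' hne
  exact indicator_of_notMem (fun hx' => disjoint_left.1 (hT.disjoint_interior hK' hK hne) hx' hx) _

theorem IsProperTriangulation.ae_le_biUnion_interior {Ω : Set Plane} {T : Finset (Set Plane)}
    (hT : IsProperTriangulation Ω T) : Ω ≤ᵐ[volume] ⋃ K ∈ T, interior K := by
  have hfr : ∀ᵐ x : Plane, ∀ K ∈ T, x ∉ frontier K :=
    (ae_ball_iff T.countable_toSet).2 fun K hK =>
      measure_eq_zero_iff_ae_notMem.1 ((hT.isTriangle K hK).convex.addHaar_frontier volume)
  filter_upwards [hfr] with x hx hxΩ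
  obtain ⟨K, hK, hxK⟩ := mem_iUnion₂.1 (hT.closure_eq ▸ subset_closure hxΩ)
  refine mem_iUnion₂.2 ⟨K, hK, ?_⟩
  by_contra hxi
  exact hx K hK ⟨subset_closure hxK, hxi⟩

theorem IsProperTriangulation.l2Norm_sub_piecewiseMeanProj_le {Ω : Set Plane}
    {T : Finset (Set Plane)} (hΩ : IsOpen Ω) (hT : IsProperTriangulation Ω T) {f : Plane → ℝ}
    (hf : MemH1 Ω f) :
    l2Norm Ω (fun x => f x - piecewiseMeanProj T f x) ≤ 2 * meshSize T * h1Seminorm Ω f := by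
  have hdisj : (T : Set (Set Plane)).PairwiseDisjoint interior :=
    fun K₁ h₁ K₂ h₂ hne => hT.disjoint_interior h₁ h₂ hne
  have hmeas : ∀ K ∈ T, MeasurableSet (interior K) := fun K _ => isOpen_interior.measurableSet
  rw [← ENNReal.pow_le_pow_left_iff two_ne_zero, mul_pow, h1Seminorm_sq]
  calc _ ≤ ∑ K ∈ T, ∫⁻ x in interior K, ‖f x - piecewiseMeanProj T f x‖ₑ ^ 2 := by
        rw [l2Norm_sq, ← lintegral_biUnion_finset hdisj hmeas]
        exact lintegral_mono' (Measure.restrict_mono_ae hT.ae_le_biUnion_interior) le_rfl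
    _ = ∑ K ∈ T, l2Norm (interior K) (fun x => f x - meanProj K f) ^ 2 := by
        refine Finset.sum_congr rfl fun K hK => ?_
        rw [l2Norm_sq]
        refine setLIntegral_congr_fun (hmeas K hK) fun x hx => ?_
        simp only [hT.piecewiseMeanProj_eq f hK hx]
    _ ≤ ∑ K ∈ T, (2 * meshSize T) ^ 2 *
          ∑ i, l2Norm (interior K) (weakPartial Ω i f) ^ 2 := by
        refine Finset.sum_le_sum fun K hK => ?_
        have hKΩ := hT.interior_subset K hK
        refine ((hT.isTriangle K hK).l2Norm_interior_sub_meanProj_sq_le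
          (hf.1.mono_measure (Measure.restrict_mono hKΩ le_rfl)) fun i =>
          (hf.isWeakPartial_weakPartial i).mono hKΩ hΩ.measurableSet).trans ?_
        gcongr
        exact Finset.le_sup (f := fun K => ediam K) hK
    _ = (2 * meshSize T) ^ 2 *
          ∑ i, ∑ K ∈ T, l2Norm (interior K) (weakPartial Ω i f) ^ 2 := by
        rw [← Finset.mul_sum, Finset.sum_comm]
    _ ≤ _ := by
        gcongr with i
        simp_rw [l2Norm_sq]
        rw [← lintegral_biUnion_finset hdisj hmeas]
        exact lintegral_mono_set (iUnion₂_subset hT.interior_subset)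

theorem mainTheorem6 :
    ∃ C : ℝ≥0, 0 < C ∧
      (∀ K : Set Plane, IsTriangle K → poincareRatio K ≤ C * Metric.ediam K) ∧
      (∀ K : Set Plane, IsTriangle K → ∀ f : Plane → ℝ, MemH1 (interior K) f →
        l2Norm K (fun x => f x - meanProj K f) ≤
          C * Metric.ediam K * h1Seminorm (interior K) f) ∧
      (∀ (Ω : Set Plane) (T : Finset (Set Plane)),
        IsOpen Ω → IsConnected Ω → Bornology.IsBounded Ω → IsProperTriangulation Ω T →
        ∀ f : Plane → ℝ, MemH1 Ω f →
          l2Norm Ω (fun x => f x - piecewiseMeanProj T f x) ≤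
            C * meshSize T * h1Seminorm Ω f) := by
  refine ⟨2, two_pos, fun K hK => iSup_le fun v => iSup_le fun hv => iSup_le fun h0 => ?_,
    fun K hK f hf => ?_, fun Ω T hΩ _ _ hT f hf => ?_⟩
  · have hmean : meanProj K v = 0 := by rw [meanProj, setAverage_eq, h0, smul_zero]
    have h := hK.l2Norm_sub_meanProj_le hv
    simp only [hmean, sub_zero] at h
    exact ENNReal.div_le_of_le_mul h
  · exact hK.l2Norm_sub_meanProj_le hf
  · exact hT.l2Norm_sub_piecewiseMeanProj_le hΩ hf
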